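/- Theorem 1 (local existence of complete slicings). All manifolds are finite-dimensional, without boundary, and all manifolds, maps and vector fields are $C^\infty$. A slicing of a vector field $Z$ on a manifold $P$ is a triple $(M,\alpha,X)$ of a manifold $M$, a smooth map $\alpha\colon M\to P$ and a smooth vector field $X$ on $M$ such that $\mathrm{T}\alpha\circ X=Z\circ\alpha$. A smooth map $\overline\alpha\colon M\times N\to P$, together with a smooth vector field $\overline X\colon M\times N\to \mathrm{T}M$ along the projection $M\times N\to M$, is a complete slicing of $Z$ if $\overline\alpha$ is surjective (or at least its image is an open dense subset of $P$) and, for each $c\in N$, $(M,\overline\alpha(\cdot,c),\overline X(\cdot,c))$ is a slicing of $Z$. Let $Z$ be a smooth vector field on a manifold $P$ and let $z_\circ\in P$ be a noncritical point of $Z$, i.e. $Z(z_\circ)\neq 0$. Let $(M,\alpha,X)$ be a slicing of $Z$ with $z_\circ=\alpha(x_\circ)$ for some $x_\circ\in M$, and such that $\alpha$ is an immersion at $x_\circ$ (i.e. the tangent map $\mathrm{T}_{x_\circ}\alpha$ is injective). Put $n=\dim P-\dim M$. Then there exist an open neighbourhood $M_\circ$ of $x_\circ$ in $M$, an open neighbourhood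 $N_\circ$ of $0$ in $\mathbb{R}^n$, an open neighbourhood $P_\circ$ of $z_\circ$ in $P$, a diffeomorphism $\overline\alpha\colon M_\circ\times N_\circ\to P_\circ$ and a smooth vector field $\overline X\colon M_\circ\times N_\circ\to\mathrm{T}M_\circ$ along the projection $M_\circ\times N_\circ\to M_\circ$ such that $(\overline\alpha,\overline X)$ is a complete slicing of $Z|_{P_\circ}$ and $\overline\alpha(\cdot,0)=\alpha|_{M_\circ}$. -/

import Mathlib

open scoped Manifold ContDiff
open TopologicalSpace

noncomputable section

variable {E : Type*} [NormedAddCommGroup E] [NormedSpace ℝ E]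
  {H : Type*} [TopologicalSpace H]
  {M : Type*} [TopologicalSpace M] [ChartedSpace H M]
  {E' : Type*} [NormedAddCommGroup E'] [NormedSpace ℝ E']
  {H' : Type*} [TopologicalSpace H']
  {N : Type*} [TopologicalSpace N] [ChartedSpace H' N]
  {F : Type*} [NormedAddCommGroup F] [NormedSpace ℝ F]
  {G : Type*} [TopologicalSpace G]
  {P : Type*} [TopologicalSpace P] [ChartedSpace G P]

/-- The vector field `X` on the manifold `M` is smooth (of class `C^∞`). -/
def IsSmoothVectorField (I : ModelWithCorners ℝ E H) [IsManifold I ∞ M]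
    (X : (x : M) → TangentSpace I x) : Prop :=
  ContMDiff I I.tangent ∞ (fun x : M => (⟨x, X x⟩ : TangentBundle I M))

/-- The restriction `Z|_U` of a vector field `Z` on `P` to an open submanifold `U` of `P`:
the pullback of `Z` along the inclusion `U → P`. -/
def restrictVectorField (K : ModelWithCorners ℝ F G)
    (Z : (z : P) → TangentSpace K z) (U : Opens P) : (z : U) → TangentSpace K z :=
  VectorField.mpullback K K (Subtype.val : U → P) Z

/-- `(M, α, X)` is a slicing of `(P, Z)`: `α : M → P` is a smooth map, `X` is a smooth vector
field on `M`, and `Tα ∘ X = Z ∘ α`. -/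
structure IsSlicing (I : ModelWithCorners ℝ E H) [IsManifold I ∞ M]
    (K : ModelWithCorners ℝ F G) (Z : (z : P) → TangentSpace K z)
    (α : M → P) (X : (x : M) → TangentSpace I x) : Prop where
  smooth_map : ContMDiff I K ∞ α
  smooth_field : IsSmoothVectorField I X
  slicing_eq : ∀ x : M, mfderiv I K α x (X x) = Z (α x)

/-- `(A, Y)` is a complete slicing of `(P, Z)`: `A : M × N → P` is a smooth map, `Y` is a smooth
vector field along the projection `M × N → M`, the map `A` is surjective or at least has open
dense image, and for each `c : N` the map `A (·, c)` and the vector field `Y (·, c)` form a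
slicing of `(P, Z)`. -/
structure IsCompleteSlicing (I : ModelWithCorners ℝ E H) [IsManifold I ∞ M]
    (J : ModelWithCorners ℝ E' H')
    (K : ModelWithCorners ℝ F G) (Z : (z : P) → TangentSpace K z)
    (A : M × N → P) (Y : (q : M × N) → TangentSpace I q.1) : Prop where
  smooth_map : ContMDiff (I.prod J) K ∞ A
  smooth_field :
    ContMDiff (I.prod J) I.tangent ∞ (fun q : M × N => (⟨q.1, Y q⟩ : TangentBundle I M))
  image_large : Function.Surjective A ∨ (IsOpen (Set.range A) ∧ Dense (Set.range A))
  slicing : ∀ c : N, IsSlicing I K Z (fun x : M => A (x, c)) (fun x : M => Y (x, c))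

end

/-! Near a noncritical point a flow box `Ξ` carries a constant field `u` to `Z`. In these
coordinates the slicing map becomes `β = Ξ.symm ∘ α`, and the slicing equation says that `Tβ` sends
`X` to `u`. A constant field is invariant under translations, so every translate `β + L c` satisfies
the same equation with the same `X`: the field of the complete slicing does not depend on `c`. If
`L` maps isomorphically onto a complement of the range of the derivative of `β` at `x₀`, then `(x,
c) ↦ β x + L c` has invertible derivative at `(x₀, 0)`, and the inverse function theorem makes it a
local diffeomorphism (`ContMDiffOn.exists_partialDiffeomorph_add`). Composing with `Ξ` and shrinking
to a product of neighbourhoods gives `A`.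

The flow box (`exists_flowBox_of_contDiff`) needs a flow smooth in time and initial point.
Picard–Lindelöf supplies a continuous one. Smoothness comes from the inverse function theorem in
`C([0, 1], F)`, applied to the integral equation with time rescaled to `[0, 1]`; this uses that
superposition by a smooth map is smooth on that space. -/

open Set Filter Topology

/-! ### Superposition and integration operators on spaces of continuous functions -/

namespace ContinuousMap

universe u

variable {K : Type*} [TopologicalSpace K] [CompactSpace K]

/-- Pointwise application of a continuous family of continuous linear maps, as a continuous
linear map between spaces of continuous functions. -/
noncomputable def clmApply (K : Type*) [TopologicalSpace K] [CompactSpace K]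
    (E F : Type*) [NormedAddCommGroup E] [NormedSpace ℝ E]
    [NormedAddCommGroup F] [NormedSpace ℝ F] :
    C(K, E →L[ℝ] F) →L[ℝ] C(K, E) →L[ℝ] C(K, F) :=
  LinearMap.mkContinuous₂
    (LinearMap.mk₂ ℝ (fun (A : C(K, E →L[ℝ] F)) (γ : C(K, E)) => (⟨fun x => A x (γ x), by fun_prop⟩ : C(K, F)))
      (fun A B γ => by ext x; simp) (fun c A γ => by ext x; simp)
      (fun A γ η => by ext x; simp) (fun c A γ => by ext x; simp)) 1
    (fun A γ => by
      rw [one_mul]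
      refine (ContinuousMap.norm_le _ (by positivity)).2 fun x => ?_
      exact ((A x).le_opNorm _).trans
        (mul_le_mul (A.norm_coe_le_norm x) (γ.norm_coe_le_norm x) (norm_nonneg _) (norm_nonneg A)))

/-- The mean value inequality is applied at each point of `K`, with a radius `δ` independent of the
point. That uniformity comes from continuity of superposition by `f'` in the sup norm. -/
theorem hasFDerivAt_postcomp {E F : Type*} [NormedAddCommGroup E] [NormedSpace ℝ E]
    [NormedAddCommGroup F] [NormedSpace ℝ F] (f : C(E, F)) (f' : C(E, E →L[ℝ] F))
    (hf : ∀ x, HasFDerivAt f (f' x) x) (γ : C(K, E)) :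
    HasFDerivAt (fun η : C(K, E) => f.comp η) (clmApply K E F (f'.comp γ)) γ := by
  rw [hasFDerivAt_iff_isLittleO, Asymptotics.isLittleO_iff]
  intro ε hε
  have hcont : Continuous fun η : C(K, E) => f'.comp η := ContinuousMap.continuous_postcomp f'
  obtain ⟨δ, hδ, hball⟩ := (Metric.continuous_iff (α := C(K, E)) (β := C(K, E →L[ℝ] F))).1 hcont γ ε hε
  filter_upwards [Metric.ball_mem_nhds γ hδ] with η hη
  refine (ContinuousMap.norm_le _ (by positivity)).2 fun x => ?_
  have hbound : ∀ y ∈ Metric.ball (γ x) δ, ‖f' y - f' (γ x)‖ ≤ ε := by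
    intro y hy
    -- The translate of `γ` by the constant `y - γ x` takes the value `y` at `x`, so closeness of
    -- functions yields a bound at the single point `y`.
    have h1 : dist (γ + ContinuousMap.const K (y - γ x)) γ < δ := by
      rw [dist_eq_norm, add_sub_cancel_left]
      refine lt_of_le_of_lt ((ContinuousMap.norm_le _ (norm_nonneg (y - γ x))).2 fun z => ?_)
        (by simpa [dist_eq_norm] using hy)
      simp
    have h2 := (ContinuousMap.dist_apply_le_dist x).trans (hball _ h1).le
    simpa [dist_eq_norm] using h2
  have hηx : η x ∈ Metric.ball (γ x) δ :=
    lt_of_le_of_lt (ContinuousMap.dist_apply_le_dist x) hη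
  have key := (convex_ball (γ x) δ).norm_image_sub_le_of_norm_hasFDerivWithin_le'
    (f := f) (f' := fun y => f' y) (φ := f' (γ x)) (C := ε)
    (fun y _ => (hf y).hasFDerivWithinAt) hbound (Metric.mem_ball_self hδ) hηx
  refine key.trans ?_
  gcongr
  exact (η - γ).norm_coe_le_norm x

/-- Superposition by a `C^n` map is a `C^n` map on the space of continuous functions. -/
theorem contDiff_postcomp_nat (n : ℕ) {E F : Type u} [NormedAddCommGroup E] [NormedSpace ℝ E]
    [NormedAddCommGroup F] [NormedSpace ℝ F] (f : C(E, F)) (hf : ContDiff ℝ n f) :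
    ContDiff ℝ n (fun γ : C(K, E) => f.comp γ) := by
  -- The inductive hypothesis is used with target `E →L[ℝ] F`, which is why `E` and `F` share a
  -- universe.
  induction n generalizing F with
  | zero => exact contDiff_zero.2 (ContinuousMap.continuous_postcomp f)
  | succ n ih =>
    have hf1 : ContDiff ℝ (n + 1) f := by exact_mod_cast hf
    obtain ⟨hd, -, hf'⟩ := contDiff_succ_iff_fderiv.1 hf1
    let f' : C(E, E →L[ℝ] F) := ⟨fderiv ℝ f, hf'.continuous⟩
    have hder := fun γ : C(K, E) => hasFDerivAt_postcomp f f' (fun x => (hd x).hasFDerivAt) γ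
    have : ContDiff ℝ (n + 1) (fun γ : C(K, E) => f.comp γ) := by
      refine contDiff_succ_iff_fderiv.2 ⟨fun γ => (hder γ).differentiableAt, by simp, ?_⟩
      have heq : fderiv ℝ (fun γ : C(K, E) => f.comp γ) =
          fun γ => clmApply K E F (f'.comp γ) := funext fun γ => (hder γ).fderiv
      rw [heq]
      exact (clmApply K E F).contDiff.comp (ih f' hf')
    exact_mod_cast this

theorem contDiff_postcomp {E F : Type u} [NormedAddCommGroup E] [NormedSpace ℝ E]
    [NormedAddCommGroup F] [NormedSpace ℝ F] (f : C(E, F)) (hf : ContDiff ℝ ∞ f) :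
    ContDiff ℝ ∞ (fun γ : C(K, E) => f.comp γ) :=
  contDiff_infty.2 fun n => contDiff_postcomp_nat n f (contDiff_infty.1 hf n)

/-- The primitive vanishing at `0`, as a continuous linear operator on `C([0, 1], E)`. -/
noncomputable def primitive (E : Type*) [NormedAddCommGroup E] [NormedSpace ℝ E] :
    C(unitInterval, E) →L[ℝ] C(unitInterval, E) :=
  LinearMap.mkContinuous
    { toFun := fun γ => ⟨fun s => ∫ r in (0 : ℝ)..s, γ (projIcc 0 1 zero_le_one r), by
        refine (intervalIntegral.continuous_primitive (fun a b => ?_) 0).comp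
          continuous_subtype_val
        exact (γ.continuous.comp continuous_projIcc).intervalIntegrable a b⟩
      map_add' := fun γ η => by
        ext s
        exact intervalIntegral.integral_add
          ((γ.continuous.comp continuous_projIcc).intervalIntegrable _ _)
          ((η.continuous.comp continuous_projIcc).intervalIntegrable _ _)
      map_smul' := fun c γ => by
        ext s
        exact intervalIntegral.integral_smul c _ } 1
    (fun γ => by
      rw [one_mul]
      refine (ContinuousMap.norm_le _ (norm_nonneg _)).2 fun s => ?_
      refine (intervalIntegral.norm_integral_le_of_norm_le_const
        (C := ‖γ‖) fun r _ => γ.norm_coe_le_norm _).trans ?_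
      have h0 := s.2.1
      have h1 := s.2.2
      rw [sub_zero, abs_of_nonneg h0]
      exact mul_le_of_le_one_right (norm_nonneg _) h1)

end ContinuousMap

/-! ### Inverse function theorem, smooth flows and straightening in a vector space -/

/-- The inverse function theorem for smooth maps, with a smooth inverse on a whole neighbourhood. -/
theorem ContDiffOn.exists_openPartialHomeomorph {E F : Type*} [NormedAddCommGroup E]
    [NormedSpace ℝ E] [CompleteSpace E] [NormedAddCommGroup F] [NormedSpace ℝ F]
    {f : E → F} {U : Set E} (hU : IsOpen U) (hf : ContDiffOn ℝ ∞ f U) {a : E} (ha : a ∈ U)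
    (f' : E ≃L[ℝ] F) (hf' : HasFDerivAt f (f' : E →L[ℝ] F) a) :
    ∃ e : OpenPartialHomeomorph E F, a ∈ e.source ∧ e.source ⊆ U ∧ (⇑e = f) ∧
      ContDiffOn ℝ ∞ e.symm e.target := by
  have hfa : ContDiffAt ℝ ∞ f a := hf.contDiffAt (hU.mem_nhds ha)
  let e₀ := hfa.toOpenPartialHomeomorph f hf' (by simp)
  have hcont : ContinuousOn (fderiv ℝ f) U := hf.continuousOn_fderiv_of_isOpen hU (by simp)
  -- Invertible derivatives form an open set; restricting to it makes the inverse smooth on the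
  -- whole target, not only at the image of `a`.
  let V : Set E := U ∩ fderiv ℝ f ⁻¹' range ((↑) : (E ≃L[ℝ] F) → E →L[ℝ] F)
  have hV : IsOpen V := hcont.isOpen_inter_preimage hU ContinuousLinearEquiv.isOpen
  have haV : a ∈ V := ⟨ha, f', hf'.fderiv.symm⟩
  refine ⟨e₀.restrOpen V hV, ⟨hfa.mem_toOpenPartialHomeomorph_source hf' (by simp), haV⟩,
    fun x hx => hx.2.1, rfl, fun y hy => ContDiffAt.contDiffWithinAt ?_⟩
  have hx := (e₀.restrOpen V hV).map_target hy
  obtain ⟨hxU, g, hg⟩ := hx.2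
  have hfx : ContDiffAt ℝ ∞ f ((e₀.restrOpen V hV).symm y) := hf.contDiffAt (hU.mem_nhds hxU)
  refine (e₀.restrOpen V hV).contDiffAt_symm (f₀' := g) hy ?_ hfx
  rw [hg]
  exact (hfx.differentiableAt (by simp)).hasFDerivAt

/-- The smooth local flow of a smooth vector field on a Banach space. -/
theorem exists_contDiffOn_flow {F : Type*} [NormedAddCommGroup F] [NormedSpace ℝ F]
    [CompleteSpace F] {f : F → F} (hf : ContDiff ℝ ∞ f) (x₀ : F) :
    ∃ (φ : ℝ × F → F) (W : Set (ℝ × F)), IsOpen W ∧ (0, x₀) ∈ W ∧ ContDiffOn ℝ ∞ φ W ∧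
      (∀ x, (0, x) ∈ W → φ (0, x) = x) ∧
      ∀ p ∈ W, HasDerivAt (fun t => φ (t, p.2)) (f (φ p)) p.1 := by
  obtain ⟨ε, hε, a, r, L, K, hr, hPL⟩ := IsPicardLindelof.of_contDiffAt_one
    (hf.contDiffAt.of_le (by simp) : ContDiffAt ℝ 1 f x₀)
  obtain ⟨α, hα, hαc⟩ :=
    (hPL 0).exists_forall_mem_closedBall_eq_hasDerivWithinAt_continuousOn
  simp only [zero_sub, zero_add] at hα hαc
  let fc : C(F, F) := ⟨f, hf.continuous⟩
  let κ : F →L[ℝ] C(unitInterval, F) := ContinuousLinearMap.const ℝ unitInterval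
  let J := ContinuousMap.primitive F
  let N : C(unitInterval, F) → C(unitInterval, F) := fun γ => fc.comp γ
  have hN : ContDiff ℝ ∞ N := ContinuousMap.contDiff_postcomp fc hf
  -- The last component vanishes exactly when `γ s = x + t ∫₀ˢ f (γ r) dr`, the equation of `s ↦ φ
  -- (t * s, x)`. Rescaling puts all trajectories on the fixed interval `[0, 1]`.
  let H : (ℝ × F) × C(unitInterval, F) → (ℝ × F) × C(unitInterval, F) :=
    fun p => (p.1, p.2 - κ p.1.2 - p.1.1 • J (N p.2))
  have hH : ContDiff ℝ ∞ H := by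
    have h1 : ContDiff ℝ ∞ fun p : (ℝ × F) × C(unitInterval, F) => J (N p.2) :=
      J.contDiff.comp (hN.comp contDiff_snd)
    have h2 : ContDiff ℝ ∞ fun p : (ℝ × F) × C(unitInterval, F) => κ p.1.2 :=
      κ.contDiff.comp (contDiff_snd.comp contDiff_fst)
    exact contDiff_fst.prodMk ((contDiff_snd.sub h2).sub
      ((contDiff_fst.comp contDiff_fst).smul h1))
  let p₀ : (ℝ × F) × C(unitInterval, F) := ((0, x₀), κ x₀)
  let T : ℝ × F →L[ℝ] C(unitInterval, F) :=
    -(κ.comp (ContinuousLinearMap.snd ℝ ℝ F)) -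
      (ContinuousLinearMap.fst ℝ ℝ F).smulRight (J (N (κ x₀)))
  -- At `t = 0` the derivative of `J ∘ N` is multiplied by zero, so the derivative of `H` is
  -- triangular with identity diagonal, hence invertible without any estimate.
  let D := (ContinuousLinearEquiv.refl ℝ (ℝ × F)).skewProd
    (ContinuousLinearEquiv.refl ℝ C(unitInterval, F)) T
  have hD : HasFDerivAt H (D : (ℝ × F) × C(unitInterval, F) →L[ℝ] _) p₀ := by
    have hJN : HasFDerivAt (fun p : (ℝ × F) × C(unitInterval, F) => J (N p.2))
        (fderiv ℝ (fun p : (ℝ × F) × C(unitInterval, F) => J (N p.2)) p₀) p₀ :=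
      ((J.contDiff.comp (hN.comp contDiff_snd)).differentiable (by simp) p₀).hasFDerivAt
    have hκ : HasFDerivAt (fun p : (ℝ × F) × C(unitInterval, F) => κ p.1.2) _ p₀ :=
      (κ.comp ((ContinuousLinearMap.snd ℝ ℝ F).comp
        (ContinuousLinearMap.fst ℝ (ℝ × F) C(unitInterval, F)))).hasFDerivAt
    have ht : HasFDerivAt (fun p : (ℝ × F) × C(unitInterval, F) => p.1.1) _ p₀ :=
      ((ContinuousLinearMap.fst ℝ ℝ F).comp
        (ContinuousLinearMap.fst ℝ (ℝ × F) C(unitInterval, F))).hasFDerivAt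
    have h := hasFDerivAt_fst.prodMk ((hasFDerivAt_snd.sub hκ).sub (ht.smul hJN))
    refine h.congr_fderiv (ContinuousLinearMap.ext fun q => Prod.ext rfl ?_)
    simp [D, T, p₀]
    abel
  obtain ⟨e, hp₀, -, heH, hsymm⟩ := hH.contDiffOn.exists_openPartialHomeomorph isOpen_univ
    (mem_univ p₀) D hD
  obtain ⟨δ, hδ, hδe⟩ := Metric.isOpen_iff.1 e.open_source p₀ hp₀
  have hα₀ : α (x₀, 0) = x₀ := (hα x₀ (Metric.mem_closedBall_self r.2)).1
  have hnhds : Metric.closedBall x₀ (r : ℝ) ×ˢ Icc (-ε) ε ∈ 𝓝 (x₀, (0 : ℝ)) :=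
    prod_mem_nhds (Metric.closedBall_mem_nhds _ hr) (Icc_mem_nhds (by linarith) hε)
  have hαat : ContinuousAt α (x₀, 0) := hαc.continuousAt hnhds
  obtain ⟨η, hη, hηα⟩ := Metric.continuousAt_iff.1 hαat (δ / 2) (half_pos hδ)
  obtain ⟨ρ, hρ, hρη, hρδ, hρε, hρr⟩ : ∃ ρ : ℝ, 0 < ρ ∧ ρ ≤ η ∧ ρ ≤ δ ∧ ρ ≤ ε ∧ ρ ≤ r :=
    ⟨min (min η δ) (min ε r), lt_min (lt_min hη hδ) (lt_min hε hr),
      (min_le_left _ _).trans (min_le_left _ _), (min_le_left _ _).trans (min_le_right _ _),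
      (min_le_right _ _).trans (min_le_left _ _), (min_le_right _ _).trans (min_le_right _ _)⟩
  have hder : ∀ t x, |t| < ρ → dist x x₀ < ρ →
      HasDerivAt (fun t => α (x, t)) (f (α (x, t))) t := by
    intro t x ht hx
    have ht' := abs_lt.1 ht
    have h1 : t ∈ Ioo (-ε) ε := ⟨by linarith, by linarith⟩
    exact ((hα x (hx.le.trans hρr)).2 t (Ioo_subset_Icc_self h1)).hasDerivAt
      (Icc_mem_nhds h1.1 h1.2)
  have hscale : ∀ t : ℝ, |t| < ρ → ∀ s ∈ Icc (0 : ℝ) 1, |t * s| < ρ := by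
    intro t ht s hs
    rw [abs_mul, abs_of_nonneg hs.1]
    exact lt_of_le_of_lt (mul_le_of_le_one_right (abs_nonneg t) hs.2) ht
  -- Continuity of `α` keeps the rescaled trajectory `c` near the constant curve `x₀`, inside
  -- `e.source`. There `e` is injective, so `c` is the curve given by the smooth inverse; its value
  -- at `s = 1` is `α (x, t)`.
  have key : ∀ t x, |t| < ρ → dist x x₀ < ρ →
      ((t, x), (0 : C(unitInterval, F))) ∈ e.target ∧
        α (x, t) = (e.symm ((t, x), 0)).2 1 := by
    intro t x ht hx
    have hcont : ContinuousOn (fun s : ℝ => α (x, t * s)) (Icc 0 1) := fun s hs =>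
      ((hder _ x (hscale t ht s hs) hx).continuousAt.comp (f := fun s => t * s)
        (by fun_prop)).continuousWithinAt
    let c : C(unitInterval, F) := ⟨fun s => α (x, t * s), hcont.domRestrict⟩
    have hc : ((t, x), c) ∈ e.source := by
      refine hδe ?_
      rw [Metric.mem_ball, Prod.dist_eq, Prod.dist_eq, max_lt_iff, max_lt_iff]
      refine ⟨⟨?_, hx.trans_le hρδ⟩, lt_of_le_of_lt ?_ (half_lt_self hδ)⟩
      · simpa [p₀] using ht.trans_le hρδ
      · refine (ContinuousMap.dist_le (half_pos hδ).le).2 fun s => ?_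
        have h1 : dist (x, t * (s : ℝ)) (x₀, 0) < η := by
          rw [Prod.dist_eq, max_lt_iff]
          refine ⟨hx.trans_le hρη, ?_⟩
          simpa using (hscale t ht s s.2).trans_le hρη
        have h2 := (hηα h1).le
        rwa [hα₀] at h2
    have hHc : e ((t, x), c) = ((t, x), 0) := by
      rw [heH]
      refine Prod.ext rfl (ContinuousMap.ext fun s => ?_)
      have hs : uIcc (0 : ℝ) s ⊆ Icc 0 1 := by
        rw [uIcc_of_le s.2.1]
        exact Icc_subset_Icc_right s.2.2
      have hd : ∀ q ∈ uIcc (0 : ℝ) s,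
          HasDerivAt (fun q => α (x, t * q)) (t • f (α (x, t * q))) q := by
        intro q hq
        have h1 := hder _ x (hscale t ht q (hs hq)) hx
        have h2 : HasDerivAt (fun q : ℝ => t * q) t q := by
          simpa using (hasDerivAt_id q).const_mul t
        exact h1.scomp q h2
      have hint : ∫ q in (0 : ℝ)..s, t • f (α (x, t * q)) = α (x, t * s) - α (x, t * 0) :=
        intervalIntegral.integral_eq_sub_of_hasDerivAt hd
          ((hf.continuous.comp_continuousOn (hcont.mono hs)).const_smul t).intervalIntegrable
      have hJ : J (N c) s = ∫ q in (0 : ℝ)..s, f (α (x, t * q)) := by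
        refine intervalIntegral.integral_congr fun q hq => ?_
        change f (α (x, t * (projIcc (0 : ℝ) 1 zero_le_one q : ℝ))) = _
        rw [projIcc_of_mem _ (hs hq)]
      rw [intervalIntegral.integral_smul, ← hJ, mul_zero,
        (hα x (hx.le.trans hρr)).1] at hint
      change α (x, t * s) - x - t • J (N c) s = 0
      rw [hint, sub_self]
    refine ⟨hHc ▸ e.map_source hc, ?_⟩
    rw [← hHc, e.left_inv hc]
    change α (x, t) = α (x, t * 1)
    rw [mul_one]
  refine ⟨fun p => α (p.2, p.1), {p | |p.1| < ρ} ∩ {p | dist p.2 x₀ < ρ},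
    (isOpen_lt (by fun_prop) continuous_const).inter (isOpen_lt (by fun_prop) continuous_const),
    ⟨by simpa using hρ, by simpa using hρ⟩, ?_, fun x hx => (hα x (hx.2.le.trans hρr)).1,
    fun p hp => hder p.1 p.2 hp.1 hp.2⟩
  have hsm : ContDiffOn ℝ ∞ (fun p : ℝ × F => (e.symm (p, 0)).2 1)
      ({p | |p.1| < ρ} ∩ {p | dist p.2 x₀ < ρ}) := by
    have h1 : ContDiffOn ℝ ∞ (fun p : ℝ × F => e.symm (p, (0 : C(unitInterval, F))))
        ({p | |p.1| < ρ} ∩ {p | dist p.2 x₀ < ρ}) :=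
      hsymm.comp (contDiff_id.prodMk contDiff_const).contDiffOn
        fun p hp => (key p.1 p.2 hp.1 hp.2).1
    exact ((ContinuousMap.evalCLM ℝ (1 : unitInterval)).contDiff.comp contDiff_snd).comp_contDiffOn
      h1
  exact hsm.congr fun p hp => (key p.1 p.2 hp.1 hp.2).2

/-- Straightening of a smooth vector field on a vector space near a noncritical point. -/
theorem exists_flowBox_of_contDiff {F : Type*} [NormedAddCommGroup F] [NormedSpace ℝ F]
    [CompleteSpace F] {f : F → F} (hf : ContDiff ℝ ∞ f) (y₀ : F) (hy₀ : f y₀ ≠ 0) :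
    ∃ e : OpenPartialHomeomorph F F, 0 ∈ e.source ∧ e 0 = y₀ ∧ ContDiffOn ℝ ∞ e e.source ∧
      ContDiffOn ℝ ∞ e.symm e.target ∧
      ∀ v ∈ e.source, fderiv ℝ e v (f y₀) = f (e v) := by
  obtain ⟨φ, W, hW, h0W, hφ, hφ0, hφd⟩ := exists_contDiffOn_flow hf y₀
  obtain ⟨ℓ, hℓ⟩ : ∃ ℓ : F →L[ℝ] ℝ, ℓ (f y₀) = 1 :=
    SeparatingDual.exists_eq_one hy₀
  -- `v` is split into a time `ℓ v` and a starting point in the hyperplane through `y₀` parallel to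
  -- `ker ℓ`. Moving `v` along `f y₀` changes only the time.
  let g : F → ℝ × F := fun v => (ℓ v, y₀ + (v - ℓ v • f y₀))
  have hg : ContDiff ℝ ∞ g := ℓ.contDiff.prodMk
    (contDiff_const.add (contDiff_id.sub (ℓ.contDiff.smul contDiff_const)))
  have hg0 : g 0 = (0, y₀) := by simp [g]
  have hgf : ∀ v, HasFDerivAt g (ℓ.prod (ContinuousLinearMap.id ℝ F - ℓ.smulRight (f y₀))) v :=
    fun v => ℓ.hasFDerivAt.prodMk
      (((hasFDerivAt_id v).sub (ℓ.hasFDerivAt.smul_const (f y₀))).const_add y₀)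
  have hU : IsOpen (g ⁻¹' W) := hW.preimage hg.continuous
  have h0 : (0 : F) ∈ g ⁻¹' W := by rw [mem_preimage, hg0]; exact h0W
  have hΘ : ContDiffOn ℝ ∞ (φ ∘ g) (g ⁻¹' W) := hφ.comp hg.contDiffOn fun _ h => h
  have hφf : ∀ p ∈ W, HasFDerivAt φ (fderiv ℝ φ p) p := fun p hp =>
    ((hφ.contDiffAt (hW.mem_nhds hp)).differentiableAt (by simp)).hasFDerivAt
  have hφt : ∀ p ∈ W, fderiv ℝ φ p (1, 0) = f (φ p) := by
    intro p hp
    have h1 : HasDerivAt (fun t : ℝ => (t, p.2)) (1, 0) p.1 :=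
      (hasDerivAt_id p.1).prodMk (hasDerivAt_const p.1 p.2)
    exact ((hφf p hp).comp_hasDerivAt p.1 h1).unique (hφd p hp)
  have hφx : ∀ w, fderiv ℝ φ (0, y₀) (0, w) = w := by
    intro w
    have h1 : HasFDerivAt (fun x : F => ((0 : ℝ), x)) (ContinuousLinearMap.inr ℝ ℝ F) y₀ :=
      hasFDerivAt_prodMk_right 0 y₀
    have h2 : HasFDerivAt (fun x : F => φ (0, x)) (ContinuousLinearMap.id ℝ F) y₀ := by
      refine (hasFDerivAt_id y₀).congr_of_eventuallyEq ?_
      filter_upwards [h1.continuousAt.preimage_mem_nhds (hW.mem_nhds h0W)] with x hx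
      exact hφ0 x hx
    exact congrArg (fun A : F →L[ℝ] F => A w) (((hφf _ h0W).comp y₀ h1).unique h2)
  have hsplit : ∀ (p : ℝ × F) (t : ℝ) (w : F),
      fderiv ℝ φ p (t, w) = t • fderiv ℝ φ p (1, 0) + fderiv ℝ φ p (0, w) := by
    intro p t w
    rw [← map_smul, ← map_add]
    simp
  have hid : HasFDerivAt (φ ∘ g) ((ContinuousLinearEquiv.refl ℝ F : F ≃L[ℝ] F) : F →L[ℝ] F) 0 := by
    have h1 := (hφf (g 0) h0).comp 0 (hgf 0)
    refine h1.congr_fderiv (ContinuousLinearMap.ext fun w => ?_)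
    rw [hg0]
    change fderiv ℝ φ (0, y₀) (ℓ w, w - ℓ w • f y₀) = w
    rw [hsplit, hφt _ h0W, hφx, hφ0 y₀ h0W]
    abel
  obtain ⟨e, h0e, heU, he, hsymm⟩ := hΘ.exists_openPartialHomeomorph hU h0 _ hid
  refine ⟨e, h0e, ?_, ?_, hsymm, fun v hv => ?_⟩
  · rw [he, Function.comp_apply, hg0, hφ0 y₀ h0W]
  · rw [he]
    exact hΘ.mono heU
  · rw [he, ((hφf (g v) (heU hv)).comp v (hgf v)).fderiv]
    change fderiv ℝ φ (g v) (ℓ (f y₀), f y₀ - ℓ (f y₀) • f y₀) = f (φ (g v))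
    rw [hℓ, one_smul, sub_self]
    exact hφt _ (heU hv)

/-! ### Partial diffeomorphisms and restriction to open submanifolds -/

namespace PartialDiffeomorph

/-- An open partial homeomorphism which is smooth in both directions, as a partial
diffeomorphism. -/
def ofOpenPartialHomeomorph {E : Type*} [NormedAddCommGroup E] [NormedSpace ℝ E]
    {H : Type*} [TopologicalSpace H] {I : ModelWithCorners ℝ E H}
    {M : Type*} [TopologicalSpace M] [ChartedSpace H M]
    {E' : Type*} [NormedAddCommGroup E'] [NormedSpace ℝ E']
    {H' : Type*} [TopologicalSpace H'] {J : ModelWithCorners ℝ E' H'}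
    {N : Type*} [TopologicalSpace N] [ChartedSpace H' N]
    (e : OpenPartialHomeomorph M N) (he : ContMDiffOn I J ∞ e e.source)
    (he' : ContMDiffOn J I ∞ e.symm e.target) : PartialDiffeomorph I J M N ∞ where
  toPartialEquiv := e.toPartialEquiv
  open_source := e.open_source
  open_target := e.open_target
  contMDiffOn_toFun := he
  contMDiffOn_invFun := he'

section

variable {E : Type*} [NormedAddCommGroup E] [NormedSpace ℝ E]
  {M : Type*} [TopologicalSpace M] [ChartedSpace E M] [IsManifold 𝓘(ℝ, E) ∞ M]

/-- The preferred chart at a point, as a partial diffeomorphism. -/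
noncomputable def chart (x : M) : PartialDiffeomorph 𝓘(ℝ, E) 𝓘(ℝ, E) M E ∞ :=
  ofOpenPartialHomeomorph (chartAt E x) contMDiffOn_chart contMDiffOn_chart_symm

theorem mem_chart_source (x : M) : x ∈ (chart (E := E) x).source := ChartedSpace.mem_chart_source x

/-- The product of a partial diffeomorphism into a vector space with the identity of another
vector space. -/
def prodId {E' : Type*} [NormedAddCommGroup E'] [NormedSpace ℝ E']
    (Φ : PartialDiffeomorph 𝓘(ℝ, E) 𝓘(ℝ, E') M E' ∞)
    (V : Type*) [NormedAddCommGroup V] [NormedSpace ℝ V] :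
    PartialDiffeomorph (𝓘(ℝ, E).prod 𝓘(ℝ, V)) 𝓘(ℝ, E' × V) (M × V) (E' × V) ∞ where
  toPartialEquiv := Φ.toPartialEquiv.prod (PartialEquiv.refl V)
  open_source := Φ.open_source.prod isOpen_univ
  open_target := Φ.open_target.prod isOpen_univ
  contMDiffOn_toFun :=
    (Φ.contMDiffOn_toFun.comp contMDiffOn_fst fun _ h => h.1).prodMk_space contMDiffOn_snd
  contMDiffOn_invFun :=
    (Φ.contMDiffOn_invFun.comp contDiff_fst.contMDiff.contMDiffOn fun _ h => h.1).prodMk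
      contDiff_snd.contMDiff.contMDiffOn

end

section

variable {E : Type*} [NormedAddCommGroup E] [NormedSpace ℝ E]
  {H : Type*} [TopologicalSpace H] {I : ModelWithCorners ℝ E H}
  {M : Type*} [TopologicalSpace M] [ChartedSpace H M]
  {E' : Type*} [NormedAddCommGroup E'] [NormedSpace ℝ E']
  {H' : Type*} [TopologicalSpace H'] {J : ModelWithCorners ℝ E' H'}
  {N : Type*} [TopologicalSpace N] [ChartedSpace H' N]

theorem isInvertible_mfderiv (Φ : PartialDiffeomorph I J M N ∞) {x : M} (hx : x ∈ Φ.source) :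
    (mfderiv I J Φ x).IsInvertible :=
  ⟨(Φ.isLocalDiffeomorphAt I J ∞ hx).mfderivToContinuousLinearEquiv (by simp), rfl⟩

end

end PartialDiffeomorph

/-- The inclusion of a nonempty open subset as a partial diffeomorphism. -/
noncomputable def TopologicalSpace.Opens.partialDiffeomorph
    {E : Type*} [NormedAddCommGroup E] [NormedSpace ℝ E]
    {H : Type*} [TopologicalSpace H] (I : ModelWithCorners ℝ E H)
    {M : Type*} [TopologicalSpace M] [ChartedSpace H M] (U : Opens M) (hU : Nonempty U) :
    PartialDiffeomorph I I U M ∞ :=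
  PartialDiffeomorph.ofOpenPartialHomeomorph (U.openPartialHomeomorphSubtypeCoe hU)
    contMDiff_subtype_val.contMDiffOn (by
      intro y hy
      rw [← ContMDiffWithinAt.subtypeVal_comp_iff]
      exact contMDiffWithinAt_id.congr_of_mem
        (fun z hz => (U.openPartialHomeomorphSubtypeCoe hU).right_inv hz) hy)

/-- `VectorField.mpullback` uses an inverse that defaults to zero; invertibility here makes
`restrictVectorField` the true restriction. -/
theorem TopologicalSpace.Opens.isInvertible_mfderiv_val
    {E : Type*} [NormedAddCommGroup E] [NormedSpace ℝ E]
    {H : Type*} [TopologicalSpace H] (I : ModelWithCorners ℝ E H)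
    {M : Type*} [TopologicalSpace M] [ChartedSpace H M] (U : Opens M) (x : U) :
    (mfderiv I I (Subtype.val : U → M) x).IsInvertible :=
  (U.partialDiffeomorph I ⟨x⟩).isInvertible_mfderiv (mem_univ x)

theorem mfderiv_val_restrictVectorField
    {F : Type*} [NormedAddCommGroup F] [NormedSpace ℝ F] {G : Type*} [TopologicalSpace G]
    {P : Type*} [TopologicalSpace P] [ChartedSpace G P] (K : ModelWithCorners ℝ F G)
    (Z : (z : P) → TangentSpace K z) (U : Opens P) (z : U) :
    mfderiv K K (Subtype.val : U → P) z (restrictVectorField K Z U z) = Z z :=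
  (U.isInvertible_mfderiv_val K z).self_apply_inverse _

theorem IsSmoothVectorField.restrict
    {F : Type*} [NormedAddCommGroup F] [NormedSpace ℝ F] [CompleteSpace F]
    {G : Type*} [TopologicalSpace G]
    {P : Type*} [TopologicalSpace P] [ChartedSpace G P] {K : ModelWithCorners ℝ F G}
    [IsManifold K ∞ P] {Z : (z : P) → TangentSpace K z} (hZ : IsSmoothVectorField K Z)
    (U : Opens P) : IsSmoothVectorField K (restrictVectorField K Z U) := by
  have : IsManifold K 1 P := IsManifold.of_le (n := ∞) (by simp)
  exact ContMDiff.mpullback_vectorField (n := ∞) hZ contMDiff_subtype_val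
    (U.isInvertible_mfderiv_val K) (by simp)

/-! ### Straightening on a manifold -/

/-- Straightening of a smooth vector field on a manifold near a noncritical point. -/
theorem IsSmoothVectorField.exists_flowBox
    {F : Type*} [NormedAddCommGroup F] [NormedSpace ℝ F] [FiniteDimensional ℝ F]
    {P : Type*} [TopologicalSpace P] [ChartedSpace F P] [IsManifold 𝓘(ℝ, F) ∞ P]
    {Z : (z : P) → TangentSpace 𝓘(ℝ, F) z} (hZ : IsSmoothVectorField 𝓘(ℝ, F) Z)
    {z₀ : P} (hz₀ : Z z₀ ≠ 0) :
    ∃ (Φ : PartialDiffeomorph 𝓘(ℝ, F) 𝓘(ℝ, F) F P ∞) (u : F), 0 ∈ Φ.source ∧ Φ 0 = z₀ ∧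
      ∀ v ∈ Φ.source, mfderiv 𝓘(ℝ, F) 𝓘(ℝ, F) Φ v u = Z (Φ v) := by
  have : IsManifold 𝓘(ℝ, F) 1 P := IsManifold.of_le (n := ∞) (by simp)
  have := FiniteDimensional.complete ℝ F
  let χ : PartialDiffeomorph 𝓘(ℝ, F) 𝓘(ℝ, F) F P ∞ := (PartialDiffeomorph.chart z₀).symm
  let y₀ : F := chartAt F z₀ z₀
  have hy₀ : y₀ ∈ χ.source := ChartedSpace.mem_chart_source z₀ |> (chartAt F z₀).map_source
  have hχy₀ : χ y₀ = z₀ := (chartAt F z₀).left_inv (ChartedSpace.mem_chart_source z₀)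
  let f₀ : F → F := VectorField.mpullback 𝓘(ℝ, F) 𝓘(ℝ, F) χ Z
  have hf₀ : ∀ y ∈ χ.source, ContDiffAt ℝ ∞ f₀ y := fun y hy =>
    contMDiffAt_vectorSpace_iff_contDiffAt.1 (ContMDiffAt.mpullback_vectorField_preimage
      (n := ∞) (hZ _) (χ.contMDiffOn.contMDiffAt (χ.open_source.mem_nhds hy))
      (χ.isInvertible_mfderiv hy) (by simp))
  have hχf₀ : ∀ y ∈ χ.source, mfderiv 𝓘(ℝ, F) 𝓘(ℝ, F) χ y (f₀ y) = Z (χ y) := fun y hy =>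
    (χ.isInvertible_mfderiv hy).self_apply_inverse _
  obtain ⟨ρ, hρ, hball⟩ := Metric.nhds_basis_closedBall.mem_iff.1 (χ.open_source.mem_nhds hy₀)
  -- The support of `b` lies in the chart domain, so `b • f₀` is smooth on all of `F`, and it agrees
  -- with `f₀` on the ball of radius `ρ / 2`. The flow box is later cut down to land in that ball.
  let b : ContDiffBump y₀ := ⟨ρ / 2, ρ, half_pos hρ, half_lt_self hρ⟩
  let f : F → F := fun y => b y • f₀ y
  have hf : ContDiff ℝ ∞ f := by
    refine contDiff_iff_contDiffAt.2 fun y => ?_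
    by_cases hy : y ∈ χ.source
    · exact b.contDiff.contDiffAt.smul (hf₀ y hy)
    · have h1 : y ∉ tsupport b := fun h => hy (hball (b.tsupport_eq ▸ h))
      refine (contDiffAt_const (c := (0 : F))).congr_of_eventuallyEq ?_
      filter_upwards [notMem_tsupport_iff_eventuallyEq.1 h1] with z hz
      simp [f, hz]
  have hfb : ∀ y ∈ Metric.ball y₀ (ρ / 2), f y = f₀ y := fun y hy => by
    simp [f, b.one_of_mem_closedBall (Metric.ball_subset_closedBall hy)]
  have hy₀b : y₀ ∈ Metric.ball y₀ (ρ / 2) := Metric.mem_ball_self (half_pos hρ)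
  have hfy₀ : f y₀ ≠ 0 := by
    rw [hfb y₀ hy₀b]
    intro h
    have h1 := hχf₀ y₀ hy₀
    have h2 : Z (χ y₀) = 0 := h1.symm.trans
      ((congrArg (mfderiv 𝓘(ℝ, F) 𝓘(ℝ, F) χ y₀) h).trans (map_zero _))
    rw [hχy₀] at h2
    exact hz₀ h2
  obtain ⟨e, h0, he0, he, he', hef⟩ := exists_flowBox_of_contDiff hf y₀ hfy₀
  let e₁ := e.trans (OpenPartialHomeomorph.ofSet (Metric.ball y₀ (ρ / 2)) Metric.isOpen_ball)
  have hsrc : ∀ v, v ∈ e₁.source ↔ v ∈ e.source ∧ e v ∈ Metric.ball y₀ (ρ / 2) := by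
    intro v
    simp [e₁]
  have htgt : ∀ v, v ∈ e₁.target → v ∈ e.target := by
    intro v
    simp [e₁]
  let Ψ : PartialDiffeomorph 𝓘(ℝ, F) 𝓘(ℝ, F) F F ∞ :=
    PartialDiffeomorph.ofOpenPartialHomeomorph e₁
      (he.mono fun v hv => ((hsrc v).1 hv).1).contMDiffOn
      (he'.mono fun v hv => htgt v hv).contMDiffOn
  refine ⟨Ψ.trans χ, f y₀, ⟨(hsrc 0).2 ⟨h0, he0 ▸ hy₀b⟩, ?_⟩, ?_, ?_⟩
  · change e 0 ∈ χ.source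
    rwa [he0]
  · change χ (e 0) = z₀
    rw [he0, hχy₀]
  · rintro v ⟨hv, hvχ⟩
    obtain ⟨hve, hvb⟩ := (hsrc v).1 hv
    have h1 : DifferentiableAt ℝ e v :=
      (he.contDiffAt (e.open_source.mem_nhds hve)).differentiableAt (by simp)
    have h2 : mfderiv 𝓘(ℝ, F) 𝓘(ℝ, F) e v (f y₀) = f₀ (e v) := by
      rw [mfderiv_eq_fderiv]
      exact (hef v hve).trans (hfb _ hvb)
    exact (mfderiv_comp_apply v (χ.mdifferentiableAt (by simp) hvχ) h1.mdifferentiableAt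
      (f y₀)).trans ((congrArg (mfderiv 𝓘(ℝ, F) 𝓘(ℝ, F) χ (e v)) h2).trans (hχf₀ (e v) hvχ))

/-! ### Completing an immersion to a local diffeomorphism -/

/-- An injective linear map is completed to an isomorphism by a linear map on a vector space of
complementary dimension. -/
theorem exists_continuousLinearEquiv_add {E F : Type*} [NormedAddCommGroup E] [NormedSpace ℝ E]
    [FiniteDimensional ℝ E] [NormedAddCommGroup F] [NormedSpace ℝ F] [FiniteDimensional ℝ F]
    (D : E →L[ℝ] F) (hD : Function.Injective D) :
    ∃ (L : EuclideanSpace ℝ (Fin (Module.finrank ℝ F - Module.finrank ℝ E)) →L[ℝ] F)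
      (T : (E × EuclideanSpace ℝ (Fin (Module.finrank ℝ F - Module.finrank ℝ E))) ≃L[ℝ] F),
      (T : _ →L[ℝ] F) = D.coprod L := by
  obtain ⟨q, hq⟩ := Submodule.exists_isCompl (LinearMap.range (D : E →ₗ[ℝ] F))
  have hrank : Module.finrank ℝ
      (EuclideanSpace ℝ (Fin (Module.finrank ℝ F - Module.finrank ℝ E))) = Module.finrank ℝ q := by
    -- Natural subtraction is harmless: injectivity of `D` gives `finrank E + finrank q = finrank
    -- F`.
    have h1 := Submodule.finrank_add_eq_of_isCompl hq
    rw [LinearMap.finrank_range_of_inj (f := (D : E →ₗ[ℝ] F)) hD] at h1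
    rw [finrank_euclideanSpace_fin]
    omega
  let g := LinearEquiv.ofFinrankEq _ _ hrank
  let T := ((LinearEquiv.ofInjective (D : E →ₗ[ℝ] F) hD).prodCongr g).trans
    (Submodule.prodEquivOfIsCompl _ q hq)
  refine ⟨LinearMap.toContinuousLinearMap (q.subtype ∘ₗ g.toLinearMap),
    T.toContinuousLinearEquiv, ContinuousLinearMap.ext fun p => ?_⟩
  simp [T]

/-- An immersion at a point into a vector space extends by translations in complementary
directions to a partial diffeomorphism. -/
theorem ContMDiffOn.exists_partialDiffeomorph_add
    {E F : Type*} [NormedAddCommGroup E] [NormedSpace ℝ E]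
    [FiniteDimensional ℝ E] [NormedAddCommGroup F] [NormedSpace ℝ F] [FiniteDimensional ℝ F]
    {M : Type*} [TopologicalSpace M] [ChartedSpace E M] [IsManifold 𝓘(ℝ, E) ∞ M]
    {β : M → F} {O : Set M} (hO : IsOpen O) (hβ : ContMDiffOn 𝓘(ℝ, E) 𝓘(ℝ, F) ∞ β O)
    {x₀ : M} (hx₀ : x₀ ∈ O) (himm : Function.Injective (mfderiv 𝓘(ℝ, E) 𝓘(ℝ, F) β x₀)) :
    ∃ (L : EuclideanSpace ℝ (Fin (Module.finrank ℝ F - Module.finrank ℝ E)) →L[ℝ] F)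
      (Φ : PartialDiffeomorph
        (𝓘(ℝ, E).prod 𝓘(ℝ, EuclideanSpace ℝ (Fin (Module.finrank ℝ F - Module.finrank ℝ E))))
        𝓘(ℝ, F) (M × EuclideanSpace ℝ (Fin (Module.finrank ℝ F - Module.finrank ℝ E))) F ∞),
      (x₀, 0) ∈ Φ.source ∧ ∀ p ∈ Φ.source, p.1 ∈ O ∧ Φ p = β p.1 + L p.2 := by
  have := FiniteDimensional.complete ℝ E
  let ψ := PartialDiffeomorph.chart (E := E) x₀
  have hψ₀ : x₀ ∈ ψ.source := PartialDiffeomorph.mem_chart_source x₀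
  have hψt : ψ x₀ ∈ ψ.symm.source := ψ.map_source hψ₀
  have hψs : ψ.symm (ψ x₀) = x₀ := ψ.left_inv hψ₀
  let U : Set E := ψ.symm.source ∩ ψ.symm ⁻¹' O
  have hU : IsOpen U :=
    ψ.symm.contMDiffOn.continuousOn.isOpen_inter_preimage ψ.symm.open_source hO
  have hU₀ : ψ x₀ ∈ U := ⟨hψt, by rw [mem_preimage, hψs]; exact hx₀⟩
  have hγ : ContDiffOn ℝ ∞ (β ∘ ψ.symm) U :=
    (hβ.comp (ψ.symm.contMDiffOn.mono inter_subset_left) inter_subset_right).contDiffOn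
  have hγd : HasFDerivAt (β ∘ ψ.symm) (fderiv ℝ (β ∘ ψ.symm) (ψ x₀)) (ψ x₀) :=
    ((hγ.contDiffAt (hU.mem_nhds hU₀)).differentiableAt (by simp)).hasFDerivAt
  have hinj : Function.Injective (fderiv ℝ (β ∘ ψ.symm) (ψ x₀)) := by
    have h1 : MDifferentiableAt 𝓘(ℝ, E) 𝓘(ℝ, F) β (ψ.symm (ψ x₀)) := by
      rw [hψs]
      exact (hβ.contMDiffAt (hO.mem_nhds hx₀)).mdifferentiableAt (by simp)
    have h2 := mfderiv_comp (ψ x₀) h1 (ψ.symm.mdifferentiableAt (by simp) hψt)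
    rw [mfderiv_eq_fderiv] at h2
    rw [h2]
    have h3 : Function.Injective (mfderiv 𝓘(ℝ, E) 𝓘(ℝ, F) β (ψ.symm (ψ x₀))) := by
      rw [hψs]
      exact himm
    exact h3.comp (ψ.symm.isInvertible_mfderiv hψt).injective
  obtain ⟨L, T, hT⟩ := exists_continuousLinearEquiv_add _ hinj
  let V := EuclideanSpace ℝ (Fin (Module.finrank ℝ F - Module.finrank ℝ E))
  have hC : ContDiffOn ℝ ∞ (fun p : E × V => (β ∘ ψ.symm) p.1 + L p.2) (Prod.fst ⁻¹' U) :=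
    (hγ.comp contDiff_fst.contDiffOn fun _ h => h).add
      (L.contDiff.comp contDiff_snd).contDiffOn
  have hCd : HasFDerivAt (fun p : E × V => (β ∘ ψ.symm) p.1 + L p.2) (T : _ →L[ℝ] F)
      (ψ x₀, 0) := by
    rw [hT]
    refine ((HasFDerivAt.comp (g := β ∘ ψ.symm) (ψ x₀, (0 : V)) hγd hasFDerivAt_fst).add
      (L.hasFDerivAt.comp (ψ x₀, (0 : V)) hasFDerivAt_snd)).congr_fderiv ?_
    ext <;> simp
  obtain ⟨e, he₀, heU, he, he'⟩ :=
    hC.exists_openPartialHomeomorph (hU.preimage continuous_fst) (a := (ψ x₀, 0)) hU₀ T hCd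
  let Ψ : PartialDiffeomorph 𝓘(ℝ, E × V) 𝓘(ℝ, F) (E × V) F ∞ :=
    PartialDiffeomorph.ofOpenPartialHomeomorph e
      (by rw [he]; exact (hC.mono heU).contMDiffOn) he'.contMDiffOn
  refine ⟨L, (ψ.prodId V).trans Ψ, ⟨⟨hψ₀, mem_univ _⟩, he₀⟩, ?_⟩
  rintro ⟨x, w⟩ ⟨⟨hx, -⟩, hxe⟩
  have hxs : ψ.symm (ψ x) = x := ψ.left_inv hx
  have hxU : ψ x ∈ U := heU hxe
  refine ⟨?_, ?_⟩
  · have := hxU.2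
    rwa [mem_preimage, hxs] at this
  · change e (ψ x, w) = β x + L w
    rw [he]
    change β (ψ.symm (ψ x)) + L w = β x + L w
    rw [hxs]

/-- A partial diffeomorphism on a product restricts to a diffeomorphism from a product of open
neighbourhoods onto an open set. -/
theorem PartialDiffeomorph.exists_diffeomorph_opens
    {E : Type*} [NormedAddCommGroup E] [NormedSpace ℝ E]
    {H : Type*} [TopologicalSpace H] {I : ModelWithCorners ℝ E H}
    {M : Type*} [TopologicalSpace M] [ChartedSpace H M]
    {E' : Type*} [NormedAddCommGroup E'] [NormedSpace ℝ E']
    {H' : Type*} [TopologicalSpace H'] {J : ModelWithCorners ℝ E' H'}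
    {N : Type*} [TopologicalSpace N] [ChartedSpace H' N]
    {F : Type*} [NormedAddCommGroup F] [NormedSpace ℝ F]
    {G : Type*} [TopologicalSpace G] {K : ModelWithCorners ℝ F G}
    {P : Type*} [TopologicalSpace P] [ChartedSpace G P]
    (Φ : PartialDiffeomorph (I.prod J) K (M × N) P ∞) {x₀ : M} {y₀ : N}
    (h₀ : (x₀, y₀) ∈ Φ.source) :
    ∃ (M₀ : Opens M) (N₀ : Opens N) (P₀ : Opens P)
      (A : Diffeomorph (I.prod J) K (M₀ × N₀) P₀ ∞),
      x₀ ∈ M₀ ∧ y₀ ∈ N₀ ∧ ∀ q : M₀ × N₀, ((q.1 : M), (q.2 : N)) ∈ Φ.source ∧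
        ((A q : P₀) : P) = Φ (q.1, q.2) := by
  obtain ⟨S, T, hS, hx₀, hT, hy₀, hST⟩ := mem_nhds_prod_iff'.1 (Φ.open_source.mem_nhds h₀)
  let M₀ : Opens M := ⟨S, hS⟩
  let N₀ : Opens N := ⟨T, hT⟩
  -- This is the image of the box `S ×ˢ T` under `Φ`, written as a preimage under the inverse so
  -- that openness is immediate.
  let P₀ : Opens P := ⟨Φ.target ∩ Φ.symm ⁻¹' (S ×ˢ T),
    Φ.symm.contMDiffOn.continuousOn.isOpen_inter_preimage Φ.open_target (hS.prod hT)⟩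
  have hsrc : ∀ q : M₀ × N₀, ((q.1 : M), (q.2 : N)) ∈ Φ.source := fun q => hST ⟨q.1.2, q.2.2⟩
  have hleft : ∀ q : M₀ × N₀, Φ.symm (Φ (q.1, q.2)) = ((q.1 : M), (q.2 : N)) :=
    fun q => Φ.left_inv (hsrc q)
  have hsymm : ContMDiff K (I.prod J) ∞ fun z : P₀ => Φ.symm z :=
    Φ.symm.contMDiffOn.comp_contMDiff contMDiff_subtype_val fun z => z.2.1
  refine ⟨M₀, N₀, P₀,
    { toFun := fun q => ⟨Φ (q.1, q.2), Φ.map_source (hsrc q), by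
        rw [mem_preimage, hleft]
        exact ⟨q.1.2, q.2.2⟩⟩
      invFun := fun z => (⟨(Φ.symm z).1, z.2.2.1⟩, ⟨(Φ.symm z).2, z.2.2.2⟩)
      left_inv := fun q => Prod.ext (Subtype.ext (congrArg Prod.fst (hleft q)))
        (Subtype.ext (congrArg Prod.snd (hleft q)))
      right_inv := fun z => Subtype.ext (Φ.right_inv z.2.1)
      contMDiff_toFun := ?_
      contMDiff_invFun := ?_ }, hx₀, hy₀, fun q => ⟨hsrc q, rfl⟩⟩
  · refine (ContMDiff.subtypeVal_comp_iff _ _).1 ?_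
    exact Φ.contMDiffOn.comp_contMDiff ((contMDiff_subtype_val.comp contMDiff_fst).prodMk
      (contMDiff_subtype_val.comp contMDiff_snd)) hsrc
  · exact ((ContMDiff.subtypeVal_comp_iff _ _).1 (contMDiff_fst.comp hsymm)).prodMk
      ((ContMDiff.subtypeVal_comp_iff _ _).1 (contMDiff_snd.comp hsymm))

/-! ### Construction of the complete slicing -/

theorem theorem1
    {E : Type*} [NormedAddCommGroup E] [NormedSpace ℝ E] [FiniteDimensional ℝ E]
    {F : Type*} [NormedAddCommGroup F] [NormedSpace ℝ F] [FiniteDimensional ℝ F]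
    {M : Type*} [TopologicalSpace M] [ChartedSpace E M] [IsManifold 𝓘(ℝ, E) ∞ M]
    {P : Type*} [TopologicalSpace P] [ChartedSpace F P] [IsManifold 𝓘(ℝ, F) ∞ P]
    (Z : (z : P) → TangentSpace 𝓘(ℝ, F) z) (hZ : IsSmoothVectorField 𝓘(ℝ, F) Z)
    (α : M → P) (X : (x : M) → TangentSpace 𝓘(ℝ, E) x)
    (hα : IsSlicing 𝓘(ℝ, E) 𝓘(ℝ, F) Z α X)
    (x₀ : M) (z₀ : P) (hz₀ : z₀ = α x₀) (hcrit : Z z₀ ≠ 0)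
    (himm : Function.Injective (mfderiv 𝓘(ℝ, E) 𝓘(ℝ, F) α x₀)) :
    ∃ (M₀ : Opens M)
      (N₀ : Opens (EuclideanSpace ℝ (Fin (Module.finrank ℝ F - Module.finrank ℝ E))))
      (P₀ : Opens P) (h0 : 0 ∈ N₀)
      (A : Diffeomorph
        (𝓘(ℝ, E).prod
          𝓘(ℝ, EuclideanSpace ℝ (Fin (Module.finrank ℝ F - Module.finrank ℝ E))))
        𝓘(ℝ, F) (M₀ × N₀) P₀ ∞)
      (Y : (q : M₀ × N₀) → TangentSpace 𝓘(ℝ, E) q.1),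
      x₀ ∈ M₀ ∧ z₀ ∈ P₀ ∧
      IsCompleteSlicing 𝓘(ℝ, E)
        𝓘(ℝ, EuclideanSpace ℝ (Fin (Module.finrank ℝ F - Module.finrank ℝ E)))
        𝓘(ℝ, F) (restrictVectorField 𝓘(ℝ, F) Z P₀) A Y ∧
      ∀ x : M₀, ((A (x, ⟨0, h0⟩) : P₀) : P) = α x := by
  subst hz₀
  have := FiniteDimensional.complete ℝ E
  obtain ⟨Ξ, u, h0, hΞ0, hΞ⟩ := hZ.exists_flowBox hcrit
  let O : Set M := α ⁻¹' Ξ.target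
  have hO : IsOpen O := Ξ.open_target.preimage hα.smooth_map.continuous
  have hx₀ : x₀ ∈ O := by
    change α x₀ ∈ Ξ.target
    rw [← hΞ0]
    exact Ξ.map_source h0
  let β : M → F := Ξ.symm ∘ α
  have hβ : ContMDiffOn 𝓘(ℝ, E) 𝓘(ℝ, F) ∞ β O :=
    Ξ.symm.contMDiffOn.comp hα.smooth_map.contMDiffOn fun _ h => h
  have hβd : ∀ x ∈ O, MDifferentiableAt 𝓘(ℝ, E) 𝓘(ℝ, F) β x := fun x hx =>
    (hβ.contMDiffAt (hO.mem_nhds hx)).mdifferentiableAt (by simp)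
  have hΞβ : ∀ x ∈ O, Ξ (β x) = α x := fun x hx => Ξ.right_inv hx
  have hβs : ∀ x ∈ O, β x ∈ Ξ.source := fun x hx => Ξ.map_target hx
  have hinj : Function.Injective (mfderiv 𝓘(ℝ, E) 𝓘(ℝ, F) β x₀) := by
    rw [mfderiv_comp x₀ (Ξ.symm.mdifferentiableAt (by simp) hx₀)
      (hα.smooth_map.mdifferentiableAt (by simp))]
    exact (Ξ.symm.isInvertible_mfderiv hx₀).injective.comp himm
  -- The derivative of `Ξ` is injective and sends both sides to `Z (α x)`: the left by the slicing
  -- equation and `Ξ ∘ β = α` near `x`, the right by straightening.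
  have hβX : ∀ x ∈ O, mfderiv 𝓘(ℝ, E) 𝓘(ℝ, F) β x (X x) = u := by
    intro x hx
    refine (Ξ.isInvertible_mfderiv (hβs x hx)).injective ?_
    have h1 : (Ξ ∘ β) =ᶠ[𝓝 x] α := by
      filter_upwards [hO.mem_nhds hx] with y hy using hΞβ y hy
    have h2 := mfderiv_comp_apply x (Ξ.mdifferentiableAt (by simp) (hβs x hx)) (hβd x hx) (X x)
    have h3 : mfderiv 𝓘(ℝ, E) 𝓘(ℝ, F) (Ξ ∘ β) x (X x) = Z (α x) :=
      (congrArg (fun A : E →L[ℝ] F => A (X x)) h1.mfderiv_eq).trans (hα.slicing_eq x)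
    have h4 : (Z (Ξ (β x)) : F) = Z (α x) := congrArg (fun z => (Z z : F)) (hΞβ x hx)
    exact h2.symm.trans (h3.trans (h4.symm.trans (hΞ _ (hβs x hx)).symm))
  obtain ⟨L, Φ, hΦ₀, hΦ⟩ := hβ.exists_partialDiffeomorph_add hO hx₀ hinj
  have hsrc₀ : (x₀, 0) ∈ (Φ.trans Ξ).source := by
    refine ⟨hΦ₀, ?_⟩
    change Φ (x₀, 0) ∈ Ξ.source
    rw [(hΦ _ hΦ₀).2, map_zero, add_zero]
    exact hβs x₀ hx₀
  obtain ⟨M₀, N₀, P₀, A, hxM, h0N, hA⟩ := (Φ.trans Ξ).exists_diffeomorph_opens hsrc₀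
  have hO' : ∀ q : M₀ × N₀, (q.1 : M) ∈ O := fun q => (hΦ _ (hA q).1.1).1
  have hs : ∀ q : M₀ × N₀, β q.1 + L q.2 ∈ Ξ.source := fun q => by
    rw [← (hΦ _ (hA q).1.1).2]
    exact (hA q).1.2
  have hAe : ∀ q : M₀ × N₀, ((A q : P₀) : P) = Ξ (β q.1 + L q.2) := fun q => by
    rw [← (hΦ _ (hA q).1.1).2]
    exact (hA q).2
  have hA0 : ∀ x : M₀, ((A (x, ⟨0, h0N⟩) : P₀) : P) = α x := fun x => by
    rw [hAe, map_zero, add_zero, hΞβ x (hO' (x, ⟨0, h0N⟩))]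
  have hX : IsSmoothVectorField 𝓘(ℝ, E) (restrictVectorField 𝓘(ℝ, E) X M₀) :=
    hα.smooth_field.restrict M₀
  -- The field is the restriction of `X` for every `c`, since translations preserve `u`.
  refine ⟨M₀, N₀, P₀, h0N, A, fun q => restrictVectorField 𝓘(ℝ, E) X M₀ q.1, hxM, ?_,
    ⟨A.contMDiff, hX.comp contMDiff_fst, Or.inl A.surjective, fun c => ⟨?_, hX, fun x => ?_⟩⟩, hA0⟩
  · rw [← hA0 ⟨x₀, hxM⟩]
    exact Subtype.coe_prop _
  · exact A.contMDiff.comp (contMDiff_id.prodMk contMDiff_const)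
  · have hAc : ContMDiff 𝓘(ℝ, E) 𝓘(ℝ, F) ∞ fun x : M₀ => A (x, c) :=
      A.contMDiff.comp (contMDiff_id.prodMk contMDiff_const)
    -- The equation may be checked after including `P₀` in `P`, where `A (·, c)` is `Ξ ∘ τ ∘ β` with
    -- `τ` the translation by `L c`.
    refine (P₀.isInvertible_mfderiv_val 𝓘(ℝ, F) (A (x, c))).injective ?_
    let Y := restrictVectorField 𝓘(ℝ, E) X M₀
    let τ : F → F := fun v => v + L c
    have hτ : MDifferentiableAt 𝓘(ℝ, F) 𝓘(ℝ, F) τ (β x) :=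
      (differentiableAt_id.add_const (L c)).mdifferentiableAt
    have hΞd : MDifferentiableAt 𝓘(ℝ, F) 𝓘(ℝ, F) Ξ (τ (β x)) :=
      Ξ.mdifferentiableAt (by simp) (hs (x, c))
    have hxO : (x : M) ∈ O := hO' (x, c)
    have hcomp : (Subtype.val ∘ fun x : M₀ => A (x, c)) = (Ξ ∘ τ ∘ β) ∘ Subtype.val :=
      funext fun y => hAe (y, c)
    have h1 := mfderiv_comp_apply x
      (contMDiff_subtype_val.mdifferentiableAt (n := ∞) (by simp) : MDifferentiableAt 𝓘(ℝ, F) 𝓘(ℝ, F)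
        (Subtype.val : P₀ → P) (A (x, c))) (hAc.mdifferentiableAt (by simp)) (Y x)
    have h2 := mfderiv_comp_apply x
      (hΞd.comp (x : M) (hτ.comp (x : M) (hβd x hxO)))
      (contMDiff_subtype_val.mdifferentiableAt (n := ∞) (by simp) : MDifferentiableAt 𝓘(ℝ, E) 𝓘(ℝ, E)
        (Subtype.val : M₀ → M) x) (Y x)
    rw [mfderiv_val_restrictVectorField] at h2
    have h3 := mfderiv_comp_apply (x : M) hΞd (hτ.comp (x : M) (hβd x hxO)) (X x)
    have h4 : mfderiv 𝓘(ℝ, E) 𝓘(ℝ, F) (τ ∘ β) x (X x) = u := by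
      refine (mfderiv_comp_apply (x : M) hτ (hβd x hxO) (X x)).trans ?_
      rw [hβX x hxO, mfderiv_eq_fderiv, fderiv_add_const, fderiv_fun_id]
      rfl
    have h5 : mfderiv 𝓘(ℝ, F) 𝓘(ℝ, F) Ξ (τ (β x)) u = Z (Ξ (τ (β x))) := hΞ _ (hs (x, c))
    have h6 : (Z (Ξ (τ (β x))) : F) = Z (A (x, c)) :=
      congrArg (fun z => (Z z : F)) (hAe (x, c)).symm
    have h7 : (mfderiv 𝓘(ℝ, E) 𝓘(ℝ, F) (Subtype.val ∘ fun x : M₀ => A (x, c)) x (Y x) : F) =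
        mfderiv 𝓘(ℝ, E) 𝓘(ℝ, F) ((Ξ ∘ τ ∘ β) ∘ Subtype.val) x (Y x) :=
      congrArg (fun g : M₀ → P => (mfderiv 𝓘(ℝ, E) 𝓘(ℝ, F) g x (Y x) : F)) hcomp
    exact h1.symm.trans (h7.trans (h2.trans (h3.trans
      ((congrArg (mfderiv 𝓘(ℝ, F) 𝓘(ℝ, F) Ξ (τ (β x))) h4).trans (h5.trans (h6.trans
        (mfderiv_val_restrictVectorField 𝓘(ℝ, F) Z P₀ (A (x, c))).symm))))))
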